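/- Theorem (The extreme states bound is lower than Thistlethwaite's bound in general). Let $D$ be a non-split link diagram on the sphere $S^2$ with $c(D)\ge 1$ crossings, that is, one whose projection graph (a 4-valent graph embedded in $S^2$) is connected. Let $|s_A|$ and $|s_B|$ be the numbers of state circles of the two extreme states of $D$, in which every crossing is $A$-split, respectively $B$-split. The extreme states bound for the spread $\max\deg\langle D\rangle-\min\deg\langle D\rangle$ of the Kauffman bracket is the number $2c(D)+2(|s_A|+|s_B|-2)$. Call an edge of the projection graph non-alternating if it is an overcrossing at both of its ends (type $+$) or an undercrossing at both of its ends (type $-$), and alternating otherwise. Let the non-alternating skeleton $G\subset S^2$ be the embedded graph dual to the non-alternating edges: it has one vertex in each complementary region of the projection graph whose boundary contains a non-alternating edge, and one edge across each non-alternating edge, of the same type $\pm$. Let $v(G)$ be its number of vertices, $\nu$ its number of edges (the number of non-alternating edges of $D$), and $n$ the number of its complementary regions in $S^2$ (the number of maximal alternating tangles of $D$). Let $|G_A|$ be the number of closed curves obtained by breaking $G$ apart at each vertex, joining each $+$ edge to the next $-$ edge in the anticlockwise sense, and $|G_B|$ the number obtained by joining each $-$ edge to the next $+$ edge in the anticlockwise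 sense. Then $$2c(D)+2(|s_A|+|s_B|-2)\;=\;4c(D)+2(|G_A|+|G_B|)-2v(G)\;\le\;4c(D)+4(n-1)-2\nu ,$$ where the right-hand side is Thistlethwaite's bound for the spread of $\langle D\rangle$. -/

import Mathlib

/-- A finite system of crossings glued along edges.  The half-edges (darts) at a crossing `c` are
`(c, 0), (c, 1), (c, 2), (c, 3)`, listed anticlockwise, with `(c, 0)` and `(c, 2)` the two ends of
the overcrossing strand and `(c, 1)` and `(c, 3)` the two ends of the undercrossing strand.  The
fixed-point-free involution `glue` joins half-edges in pairs to edges.  The underlying surface is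
the closed oriented one in which every boundary walk of the 4-valent graph bounds a disc. -/
structure CrossingMap (C : Type*) where
  glue : C × ZMod 4 → C × ZMod 4
  glue_glue : ∀ d, glue (glue d) = d
  glue_ne : ∀ d, glue d ≠ d

namespace CrossingMap

variable {C : Type*} (D : CrossingMap C)

/-- The edges of the projection graph. -/
def Edge : Type _ := Quot (fun d e : C × ZMod 4 => e = D.glue d)

/-- Leave a crossing along the half-edge `d`, run along its edge and turn left at the crossing at
the other end: the result is the half-edge along which one leaves that crossing.  Iterating keeps
one and the same complementary region of the projection graph on the left-hand side. -/
def leftTurn (d : C × ZMod 4) : C × ZMod 4 := ((D.glue d).1, (D.glue d).2 - 1)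

/-- The complementary regions (faces) of the projection graph: the cycles of `leftTurn`.  The half
edge `d` belongs to the face on its left (when it is directed away from its crossing). -/
def Face : Type _ := Quot (fun d e : C × ZMod 4 => e = D.leftTurn d)

/-- The face on the left of a half-edge. -/
def face (d : C × ZMod 4) : D.Face := Quot.mk _ d

/-- The connected components of the projection graph. -/
def Component : Type _ := Quot (fun c c' : C => ∃ i j, D.glue (c, i) = (c', j))

end CrossingMap

/-- A link diagram on the sphere: every component of the projection graph has genus `0`, that is,
vertices minus edges plus faces is twice the number of components. -/
structure LinkDiagram (C : Type*) extends CrossingMap C where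
  planar : (Nat.card C : ℤ) - Nat.card toCrossingMap.Edge + Nat.card toCrossingMap.Face
    = 2 * Nat.card toCrossingMap.Component

namespace LinkDiagram

variable {C : Type*} (D : LinkDiagram C)

/-- The diagram is not split: its projection graph is connected (and not empty). -/
def IsNonsplit : Prop := Nat.card D.Component = 1

/-- The number `c(D)` of crossings. -/
noncomputable def crossingNumber (_ : LinkDiagram C) : ℕ := Nat.card C

/-- The half-edge `d` is an end of an overcrossing strand. -/
def IsOver (d : C × ZMod 4) : Prop := d.2 = 0 ∨ d.2 = 2

/-! ### States

The quadrant between `(c, i)` and `(c, i + 1)` is swept out by the overcrossing strand when that is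
turned anticlockwise if and only if `i` is `0` or `2`; these are the `A` quadrants.  The `A`-split
unites the two `A` quadrants, so that its two arcs cut off the two `B` quadrants: they join the half
edges `1, 2` and `3, 0`.  The arcs of the `B`-split join `0, 1` and `2, 3`. -/

/-- The two labels of a crossing in a state. -/
inductive Label
  | A
  | B

open Classical in
/-- The half-edge that is joined to `d` at its crossing, when this is split as the label says. -/
noncomputable def splitPartner : Label → C × ZMod 4 → C × ZMod 4
  | .A, d => if IsOver d then (d.1, d.2 - 1) else (d.1, d.2 + 1)
  | .B, d => if IsOver d then (d.1, d.2 + 1) else (d.1, d.2 - 1)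

/-- The state circles of the state `s`. -/
def StateCircle (s : C → Label) : Type _ :=
  Quot (fun d e : C × ZMod 4 => e = D.glue d ∨ e = splitPartner (s d.1) d)

/-- The number `|s|` of state circles. -/
noncomputable def numCircles (s : C → Label) : ℕ := Nat.card (D.StateCircle s)

/-- The extreme state in which all crossings are labelled `A`. -/
def stateA (_ : LinkDiagram C) : C → Label := fun _ => .A

/-- The extreme state in which all crossings are labelled `B`. -/
def stateB (_ : LinkDiagram C) : C → Label := fun _ => .B

/-- The extreme states bound `2 c(D) + 2 (|s_A| + |s_B| - 2)` for the spread of the bracket. -/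
noncomputable def extremeStatesBound : ℤ :=
  2 * (D.crossingNumber : ℤ)
    + 2 * ((D.numCircles D.stateA : ℤ) + (D.numCircles D.stateB : ℤ) - 2)

/-! ### The non-alternating skeleton -/

/-- The edge that contains the half-edge `d` is non-alternating: it passes over at both its ends or
under at both its ends. -/
def IsNonalternating (d : C × ZMod 4) : Prop := IsOver d ↔ IsOver (D.glue d)

/-- The half-edges of the skeleton `G`.  The edge of `G` dual to a non-alternating edge of `D` has
two halves, one in each of the faces along that edge; `d` stands for the half that lies in the face
to the left of `d`. -/
def HalfEdge : Type _ := {d : C × ZMod 4 // D.IsNonalternating d}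

/-- The edges of `G`, one for each non-alternating edge of `D`. -/
def SkeletonEdge : Type _ := Quot (fun h k : D.HalfEdge => k.1 = D.glue h.1)

/-- The vertices of `G`, one in each complementary region of the projection graph whose boundary
contains non-alternating edges. -/
def SkeletonVertex : Type _ := {f : D.Face // ∃ d, D.IsNonalternating d ∧ D.face d = f}

/-- `k` is the half-edge of `G` that follows `h` in the anticlockwise order around their common
vertex: the first non-alternating edge after `h` in the anticlockwise boundary walk of the face. -/
def IsNext (h k : D.HalfEdge) : Prop :=
  ∃ m : ℕ, 0 < m ∧ D.leftTurn^[m] h.1 = k.1 ∧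
    ∀ j : ℕ, 0 < j → j < m → ¬ D.IsNonalternating (D.leftTurn^[j] h.1)

/-- The curves `G_A`: at every vertex of `G`, each `+` (over) edge is joined to the next edge in the
anticlockwise sense. -/
def CurveA : Type _ :=
  Quot (fun h k : D.HalfEdge => k.1 = D.glue h.1 ∨ (IsOver h.1 ∧ D.IsNext h k))

/-- The curves `G_B`: at every vertex of `G`, each `-` (under) edge is joined to the next edge in
the anticlockwise sense. -/
def CurveB : Type _ :=
  Quot (fun h k : D.HalfEdge => k.1 = D.glue h.1 ∨ (¬ IsOver h.1 ∧ D.IsNext h k))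

/-- The complementary regions of `G` in the sphere, equivalently the maximal alternating tangles
of `D`.  The graph dual to the whole projection graph cuts the sphere into discs, one around each
crossing, and `G` is a part of this dual graph: a region of the complement of `G` consists of
the discs that are connected to each other across dual edges not in `G`, that is, along alternating
edges of `D`.  (All discs around a dual vertex not in `G` are connected in this way.) -/
def Region : Type _ :=
  Quot (fun c c' : C => ∃ i j, D.glue (c, i) = (c', j) ∧ ¬ D.IsNonalternating (c, i))

/-- The number `v(G)` of vertices of the skeleton. -/
noncomputable def numVertices : ℕ := Nat.card D.SkeletonVertex

/-- The number `ν` of non-alternating edges, which is the number of edges of the skeleton. -/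
noncomputable def numNonalternating : ℕ := Nat.card D.SkeletonEdge

/-- The number `n` of complementary regions of the skeleton. -/
noncomputable def numRegions : ℕ := Nat.card D.Region

/-- The number `|G_A|` of curves in `G_A`. -/
noncomputable def numCurvesA : ℕ := Nat.card D.CurveA

/-- The number `|G_B|` of curves in `G_B`. -/
noncomputable def numCurvesB : ℕ := Nat.card D.CurveB

/-- The extreme states bound in terms of the skeleton: `4 c(D) + 2 (|G_A| + |G_B|) - 2 v(G)`. -/
noncomputable def skeletonBound : ℤ :=
  4 * (D.crossingNumber : ℤ) + 2 * ((D.numCurvesA : ℤ) + (D.numCurvesB : ℤ))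
    - 2 * (D.numVertices : ℤ)

/-- Thistlethwaite's bound `4 c(D) + 4 (n - 1) - 2 ν`. -/
noncomputable def thistlethwaiteBound : ℤ :=
  4 * (D.crossingNumber : ℤ) + 4 * ((D.numRegions : ℤ) - 1) - 2 * (D.numNonalternating : ℤ)

end LinkDiagram

/-! ### Quotients of finite types and spaces of invariant functions -/

/-! Along an alternating edge, a circle of an extreme state follows the boundary of one face; along
a non-alternating edge it passes to the face on the other side. So the circles of $s_A$ and $s_B$
are the curves of $G_A$ and $G_B$, together with one circle, in exactly one of the two states, for
each face without non-alternating edges (`card_circle`, `card_avoidingOrbit`). By Euler's formula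
there are $c+2$ faces, and $v(G)$ of them do meet non-alternating edges. Hence
$|s_A|+|s_B|=|G_A|+|G_B|+c+2-v(G)$, which is the equality.

For the inequality, let $k$ be the number of components of $G$. The signs alternate around each
vertex of $G$, so the $2\nu$ half-edges of $G$ carry three perfect matchings: the edges of $G$, the
corners used by $G_A$ and the corners used by $G_B$. The cycles in two of these colours are the
curves of $G_A$, the curves of $G_B$ and the vertices of $G$. Filling them with discs gives a closed
surface with $k$ components, and $\chi\le 2k$ reads $|G_A|+|G_B|+v(G)\le\nu+2k$
(`card_curve_add_card_curve_le`). Euler's inequality for $G$ in the sphere is $k+1\le v(G)-\nu+n$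
(`card_quot_add_numNonalternating_le`, with the face count). Eliminating $k$ gives the bound.

Both Euler inequalities are linear algebra over `ZMod 2`: the number of classes is the dimension of
the space of invariant functions, and the dimensions of two orthogonal subspaces add up to at most
the number of points. -/

theorem quot_mk_eq_iff_of_involutive {X : Type*} {τ : X → X} (hτ : Function.Involutive τ) (x y : X) :
    Quot.mk (fun x y => y = τ x) x = Quot.mk (fun x y => y = τ x) y ↔ y = x ∨ y = τ x := by
  constructor
  · intro h
    replace h := Quot.eqvGen_exact h
    induction h with
    | rel _ _ h' => exact Or.inr h'
    | refl => exact Or.inl rfl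
    | symm a b _ ih =>
      rcases ih with rfl | rfl
      · exact Or.inl rfl
      · exact Or.inr (hτ _).symm
    | trans a b c h₁ h₂ ih₁ ih₂ =>
      rcases ih₁ with rfl | rfl <;>
        rcases ih₂ with rfl | rfl
      · exact Or.inl rfl
      · exact Or.inr rfl
      · exact Or.inr rfl
      · exact Or.inl (hτ _)
  · rintro (rfl | rfl)
    · rfl
    · exact Quot.sound rfl

/-- An involution of a finite set has half as many orbits as there are points and fixed points. -/
theorem two_mul_card_quot_of_involutive {X : Type*} [Finite X] {τ : X → X}
    (hτ : Function.Involutive τ) :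
    2 * Nat.card (Quot fun x y => y = τ x) = Nat.card X + Nat.card {x // τ x = x} := by
  classical
  let Q := Quot fun x y => y = τ x
  let mk : X → Q := Quot.mk _
  have hout (q : Q) : mk q.out = q := Quot.out_eq q
  -- The chosen representative of an orbit takes the flag `true`. The flag `false` goes to the other
  -- point or, in an orbit of size one, to the second copy of the fixed point.
  let f : X ⊕ {x // τ x = x} → Q × Bool :=
    Sum.elim (fun x => (mk x, decide (x = (mk x).out))) fun x => (mk x.1, false)
  have hmk (x y : X) : mk x = mk y ↔ y = x ∨ y = τ x := quot_mk_eq_iff_of_involutive hτ x y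
  have hx (x : X) : (mk x).out = x ∨ (mk x).out = τ x := (hmk _ _).1 (hout (mk x)).symm
  have hf : Function.Bijective f := by
    constructor
    · rintro (x | ⟨x, hx'⟩) (y | ⟨y, hy'⟩) h <;>
        simp only [f, Sum.elim_inl, Sum.elim_inr, Prod.mk.injEq] at h <;>
        obtain ⟨h₁, h₂⟩ := h
      · have := (hmk _ _).1 h₁
        have := hx x
        have := hx y
        grind
      · have := (hmk _ _).1 h₁
        have := hx x
        grind
      · have := (hmk _ _).1 h₁
        have := hx y
        grind
      · have := (hmk _ _).1 h₁
        grind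
    · rintro ⟨q, b⟩
      cases b
      · by_cases h : τ q.out = q.out
        · exact ⟨Sum.inr ⟨_, h⟩, by simp [f, hout]⟩
        · refine ⟨Sum.inl (τ q.out), ?_⟩
          have : mk (τ q.out) = q := by
            rw [← hout q, hout]; exact ((hmk _ _).2 (Or.inr rfl)).symm.trans (hout q)
          simp [f, this, h]
      · exact ⟨Sum.inl q.out, by simp [f, hout]⟩
  have := Nat.card_eq_of_bijective f hf
  rw [Nat.card_sum, Nat.card_prod, Nat.card_eq_fintype_card (α := Bool), Fintype.card_bool,
    mul_comm] at this
  exact this.symm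

theorem two_mul_card_quot_of_involutive_of_ne {X : Type*} [Finite X] {τ : X → X}
    (hτ : Function.Involutive τ) (hne : ∀ x, τ x ≠ x) :
    2 * Nat.card (Quot fun x y => y = τ x) = Nat.card X := by
  have : IsEmpty {x // τ x = x} := ⟨fun x => hne x.1 x.2⟩
  rw [two_mul_card_quot_of_involutive hτ, Nat.card_of_isEmpty (α := {x // τ x = x}), add_zero]

section Invariants

variable {X : Type*}

/-- The functions modulo 2 that take equal values on related points. -/
def invariants (r : X → X → Prop) : Submodule (ZMod 2) (X → ZMod 2) where
  carrier := {f | ∀ x y, r x y → f x = f y}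
  add_mem' hf hg x y h := by simp [hf x y h, hg x y h]
  zero_mem' _ _ _ := rfl
  smul_mem' a f hf x y h := by simp [hf x y h]

theorem mem_invariants {r : X → X → Prop} {f : X → ZMod 2} :
    f ∈ invariants r ↔ ∀ x y, r x y → f x = f y := Iff.rfl

theorem invariants_or (r s : X → X → Prop) :
    invariants (fun x y => r x y ∨ s x y) = invariants r ⊓ invariants s := by
  ext f
  simp only [Submodule.mem_inf, mem_invariants]
  grind

theorem finrank_invariants [Finite X] (r : X → X → Prop) :
    Module.finrank (ZMod 2) (invariants r) = Nat.card (Quot r) := by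
  classical
  have := Fintype.ofFinite X
  have := Fintype.ofFinite (Quot r)
  have hr : invariants r = LinearMap.range (LinearMap.funLeft (ZMod 2) (ZMod 2) (Quot.mk r)) := by
    ext f
    constructor
    · intro hf
      exact ⟨Quot.lift f hf, rfl⟩
    · rintro ⟨g, rfl⟩ x y h
      exact congrArg g (Quot.sound h)
  rw [hr, LinearMap.finrank_range_of_inj
    (LinearMap.funLeft_injective_of_surjective _ _ _ Quot.mk_surjective),
    Module.finrank_fintype_fun_eq_card, Nat.card_eq_fintype_card]

theorem finrank_invariants_inf [Finite X] (r s : X → X → Prop) :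
    Module.finrank (ZMod 2) ↥(invariants r ⊓ invariants s) =
      Nat.card (Quot fun x y => r x y ∨ s x y) := by
  rw [← invariants_or, finrank_invariants]

/-! ### Orthogonality modulo 2 and the Euler inequality for three matchings -/

theorem finrank_add_finrank_le_of_dotProduct_eq_zero [Fintype X]
    (S T : Submodule (ZMod 2) (X → ZMod 2)) (h : ∀ f ∈ S, ∀ g ∈ T, f ⬝ᵥ g = 0) :
    Module.finrank (ZMod 2) S + Module.finrank (ZMod 2) T ≤ Nat.card X := by
  classical
  have hle : T.map (dotProductEquiv (ZMod 2) X).toLinearMap ≤ S.dualAnnihilator := by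
    rintro _ ⟨g, hg, rfl⟩
    rw [Submodule.mem_dualAnnihilator]
    intro f hf
    simpa [dotProduct_comm] using h f hf g hg
  have h₁ := Submodule.finrank_mono hle
  rw [LinearEquiv.finrank_map_eq] at h₁
  have h₂ := Subspace.finrank_add_finrank_dualAnnihilator_eq S
  rw [Module.finrank_fintype_fun_eq_card, ← Nat.card_eq_fintype_card] at h₂
  omega

/-- A form of the inequality `χ ≤ 2` per component, for a closed surface with a cubic cell
decomposition in which the faces have three colours. -/
theorem finrank_inf_add_finrank_inf_add_finrank_inf_le [Fintype X]
    (A B E : Submodule (ZMod 2) (X → ZMod 2)) (hA : ∀ f ∈ A, ∀ g ∈ A, f ⬝ᵥ g = 0)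
    (hB : ∀ f ∈ B, ∀ g ∈ B, f ⬝ᵥ g = 0) (hE : ∀ f ∈ E, ∀ g ∈ E, f ⬝ᵥ g = 0) :
    Module.finrank (ZMod 2) ↥(E ⊓ A) + Module.finrank (ZMod 2) ↥(E ⊓ B)
      + Module.finrank (ZMod 2) ↥(A ⊓ B) + Module.finrank (ZMod 2) E
      ≤ Nat.card X + 2 * Module.finrank (ZMod 2) ↥(E ⊓ (A ⊓ B)) := by
  -- Each summand on the left shares one of the self-orthogonal spaces `A`, `B`, `E` with each
  -- summand on the right. Both sums have defect `E ⊓ (A ⊓ B)`, whence the factor 2.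
  have h := finrank_add_finrank_le_of_dotProduct_eq_zero (E ⊓ A ⊔ E ⊓ B) (A ⊓ B ⊔ E) <| by
    intro f hf g hg
    obtain ⟨f₁, ⟨h₁E, h₁A⟩, f₂, ⟨h₂E, h₂B⟩, rfl⟩ := Submodule.mem_sup.1 hf
    obtain ⟨g₁, ⟨h₁A', h₁B'⟩, g₂, h₂E', rfl⟩ := Submodule.mem_sup.1 hg
    simp only [add_dotProduct, dotProduct_add, hA _ h₁A _ h₁A', hB _ h₂B _ h₁B',
      hE _ h₁E _ h₂E', hE _ h₂E _ h₂E', add_zero]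
  have h₁ := Submodule.finrank_sup_add_finrank_inf_eq (E ⊓ A) (E ⊓ B)
  have h₂ := Submodule.finrank_sup_add_finrank_inf_eq (A ⊓ B) E
  rw [← inf_inf_distrib_left] at h₁
  rw [inf_comm (A ⊓ B) E] at h₂
  omega

theorem dotProduct_eq_zero_of_involutive [Fintype X] {τ : X → X} (hτ : Function.Involutive τ)
    (hne : ∀ x, τ x ≠ x) {f g : X → ZMod 2} (hf : ∀ x, f x = f (τ x)) (hg : ∀ x, g x = g (τ x)) :
    f ⬝ᵥ g = 0 :=
  Finset.sum_involution (fun x _ => τ x)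
    (fun x _ => by rw [← hf, ← hg]; exact CharTwo.add_self_eq_zero _)
    (fun x _ _ => hne x) (fun x _ => Finset.mem_univ _) (fun x _ => hτ x)

/-- Since `e` exchanges `p` and its complement, the pairs `x`, `e x` with `p x` form a perfect
matching. The two terms of a pair agree, so they cancel modulo 2. -/
theorem dotProduct_eq_zero_of_perm [Fintype X] (e : Equiv.Perm X) (p : X → Prop)
    (hp : ∀ x, p (e x) ↔ ¬ p x) {f g : X → ZMod 2} (hf : ∀ x, p x → f x = f (e x))
    (hg : ∀ x, p x → g x = g (e x)) : f ⬝ᵥ g = 0 := by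
  classical
  have h : ∑ x, (if p x then 0 else f x * g x) = ∑ x, if p x then f x * g x else 0 := by
    rw [← Equiv.sum_comp e]
    refine Finset.sum_congr rfl fun x _ => ?_
    by_cases hx : p x
    · simp [hp, hx, hf x hx, hg x hx]
    · simp [hp, hx]
  calc f ⬝ᵥ g = ∑ x, ((if p x then 0 else f x * g x) + if p x then f x * g x else 0) :=
        Finset.sum_congr rfl fun x _ => by split_ifs <;> simp
    _ = 0 := by rw [Finset.sum_add_distrib, h]; exact CharTwo.add_self_eq_zero _

end Invariants
/-! ### First returns of an injective map of a finite set -/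

section FirstReturn

variable {H : Type*} (φ : H → H) (N : H → Prop)

/-- `k` is the first point of `N` on the forward orbit of `h`, after `h` itself. -/
def IsFirstReturn (h k : {d // N d}) : Prop :=
  ∃ m : ℕ, 0 < m ∧ φ^[m] h.1 = k.1 ∧ ∀ j : ℕ, 0 < j → j < m → ¬ N (φ^[j] h.1)

/-- The orbits of `φ`. -/
abbrev OrbitQuot : Type _ := Quot fun d e : H => e = φ d

/-- The orbits of `φ` that do not meet `N`. -/
abbrev AvoidingOrbit : Type _ := {q : OrbitQuot φ // ¬ ∃ d, N d ∧ Quot.mk _ d = q}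

variable {φ N}

theorem quot_mk_apply (d : H) : (Quot.mk _ (φ d) : OrbitQuot φ) = Quot.mk _ d :=
  (Quot.sound (r := fun d e => e = φ d) rfl).symm

theorem quot_mk_iterate (j : ℕ) (d : H) :
    (Quot.mk _ (φ^[j] d) : OrbitQuot φ) = Quot.mk _ d := by
  induction j with
  | zero => rfl
  | succ j ih =>
    rw [Function.iterate_succ_apply', quot_mk_apply, ih]

theorem exists_pos_iterate_eq [Finite H] (hφ : Function.Injective φ) (d : H) :
    ∃ m, 0 < m ∧ φ^[m] d = d :=
  Function.mem_periodicPts.1 (hφ.mem_periodicPts d)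

theorem exists_iterate_eq_of_quot_mk_eq [Finite H] (hφ : Function.Injective φ) {d e : H}
    (h : (Quot.mk _ d : OrbitQuot φ) = Quot.mk _ e) : ∃ j, φ^[j] d = e := by
  replace h := Quot.eqvGen_exact h
  induction h with
  | rel _ _ h' => exact ⟨1, h'.symm⟩
  | refl => exact ⟨0, rfl⟩
  | symm a b _ ih =>
    obtain ⟨j, rfl⟩ := ih
    obtain ⟨m, hm, h⟩ := exists_pos_iterate_eq hφ a
    -- With the `j` steps already made this is `m * j` steps, a multiple of the period `m` of `a`.
    refine ⟨(m - 1) * j, ?_⟩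
    rw [← Function.iterate_add_apply, ← Nat.succ_mul, Nat.succ_eq_add_one, Nat.sub_add_cancel hm]
    exact Function.IsPeriodicPt.mul_const h j
  | trans a b c _ _ ih₁ ih₂ =>
    obtain ⟨i, rfl⟩ := ih₁
    obtain ⟨j, rfl⟩ := ih₂
    exact ⟨j + i, Function.iterate_add_apply _ _ _ _⟩

theorem exists_isFirstReturn [Finite H] (hφ : Function.Injective φ) (h : {d // N d}) :
    ∃ k, IsFirstReturn φ N h k := by
  classical
  have hex : ∃ m, 0 < m ∧ N (φ^[m] h.1) := by
    obtain ⟨m, hm, hh⟩ := exists_pos_iterate_eq hφ h.1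
    exact ⟨m, hm, hh.symm ▸ h.2⟩
  refine ⟨⟨_, (Nat.find_spec hex).2⟩, Nat.find hex, (Nat.find_spec hex).1, rfl, ?_⟩
  exact fun j hj hlt hN => Nat.find_min hex hlt ⟨hj, hN⟩

/-- Cancelling the shorter number of steps puts one starting point on the path of the other,
strictly before the latter's first return, so the two coincide. -/
theorem IsFirstReturn.left_unique (hφ : Function.Injective φ) {h h' k : {d // N d}}
    (hk : IsFirstReturn φ N h k) (hk' : IsFirstReturn φ N h' k) : h = h' := by
  have key : ∀ {h h' : {d // N d}} {m m' : ℕ}, m ≤ m' → 0 < m → φ^[m] h.1 = φ^[m'] h'.1 →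
      (∀ j : ℕ, 0 < j → j < m' → ¬ N (φ^[j] h'.1)) → h = h' := by
    intro h h' m m' hle hm e hlt
    obtain ⟨i, rfl⟩ := Nat.exists_eq_add_of_le hle
    rw [Function.iterate_add_apply] at e
    replace e := hφ.iterate m e
    rcases Nat.eq_zero_or_pos i with rfl | hi
    · exact Subtype.ext e
    · exact absurd (e ▸ h.2) (hlt i hi (by omega))
  obtain ⟨m, hm, e, hlt⟩ := hk
  obtain ⟨m', hm', e', hlt'⟩ := hk'
  rcases le_total m m' with hle | hle
  · exact key hle hm (e.trans e'.symm) hlt'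
  · exact (key hle hm' (e'.trans e.symm) hlt).symm

/-- The permutation of `N` given by the first return. -/
noncomputable def firstReturn [Finite H] (hφ : Function.Injective φ) (N : H → Prop) :
    Equiv.Perm {d // N d} :=
  Equiv.ofBijective (fun h => (exists_isFirstReturn hφ h).choose) <|
    Finite.injective_iff_bijective.1 fun h h' e =>
      (exists_isFirstReturn hφ h).choose_spec.left_unique hφ
        (e ▸ (exists_isFirstReturn hφ h').choose_spec)

theorem isFirstReturn_firstReturn [Finite H] (hφ : Function.Injective φ) (h : {d // N d}) :
    IsFirstReturn φ N h (firstReturn hφ N h) :=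
  (exists_isFirstReturn hφ h).choose_spec

theorem IsFirstReturn.quot_mk_eq {h k : {d // N d}} (hk : IsFirstReturn φ N h k) :
    (Quot.mk _ h.1 : OrbitQuot φ) = Quot.mk _ k.1 := by
  obtain ⟨m, -, e, -⟩ := hk
  rw [← e, quot_mk_iterate]

theorem quot_mk_isFirstReturn_eq [Finite H] (hφ : Function.Injective φ) (h k : {d // N d}) (m : ℕ)
    (e : φ^[m] h.1 = k.1) : Quot.mk (IsFirstReturn φ N) h = Quot.mk (IsFirstReturn φ N) k := by
  induction m using Nat.strong_induction_on generalizing h with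
  | _ m ih =>
    rcases Nat.eq_zero_or_pos m with rfl | hm
    · exact congrArg _ (Subtype.ext e)
    · have hk := isFirstReturn_firstReturn hφ h
      refine (Quot.sound hk).trans ?_
      obtain ⟨i, hi, e', hlt⟩ := hk
      have hle : i ≤ m := by
        by_contra hlt'
        exact hlt m hm (by omega) (e ▸ k.2)
      refine ih (m - i) (by omega) _ ?_
      rw [← e', ← Function.iterate_add_apply, Nat.sub_add_cancel hle, e]

/-- The orbits of the first return map on `N` are the orbits that meet `N`. -/
theorem card_quot_isFirstReturn [Finite H] (hφ : Function.Injective φ) :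
    Nat.card (Quot (IsFirstReturn φ N)) =
      Nat.card {q : OrbitQuot φ // ∃ d, N d ∧ Quot.mk _ d = q} := by
  refine Nat.card_eq_of_bijective
    (Quot.lift (fun h => ⟨Quot.mk _ h.1, h.1, h.2, rfl⟩) fun h k hk => Subtype.ext hk.quot_mk_eq)
    ⟨?_, ?_⟩
  · rintro ⟨h⟩ ⟨k⟩ e
    obtain ⟨m, hm⟩ := exists_iterate_eq_of_quot_mk_eq hφ (Subtype.ext_iff.1 e)
    exact quot_mk_isFirstReturn_eq hφ h k m hm
  · rintro ⟨_, d, hd, rfl⟩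
    exact ⟨Quot.mk _ ⟨d, hd⟩, rfl⟩

open Classical in
/-- The first point of `N` on the forward orbit of `d`, or the orbit of `d` if it avoids `N`. -/
noncomputable def firstVisit [Finite H] (hφ : Function.Injective φ) (N : H → Prop) (d : H) :
    {d // N d} ⊕ AvoidingOrbit φ N :=
  if h : ∃ j, N (φ^[j] d) then .inl ⟨φ^[Nat.find h] d, Nat.find_spec h⟩
  else .inr ⟨Quot.mk _ d, by
    rintro ⟨e, he, heq⟩
    obtain ⟨j, rfl⟩ := exists_iterate_eq_of_quot_mk_eq hφ heq.symm
    exact h ⟨j, he⟩⟩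

theorem firstVisit_eq_inl [Finite H] (hφ : Function.Injective φ) {d : H} {j : ℕ} (hj : N (φ^[j] d)) (hlt : ∀ i < j, ¬ N (φ^[i] d)) :
    firstVisit hφ N d = .inl ⟨φ^[j] d, hj⟩ := by
  classical
  have hex : ∃ j, N (φ^[j] d) := ⟨j, hj⟩
  have : Nat.find hex = j := (Nat.find_eq_iff hex).2 ⟨hj, hlt⟩
  rw [firstVisit, dif_pos hex]
  congr! 3

theorem firstVisit_of_mem [Finite H] (hφ : Function.Injective φ) {d : H} (hd : N d) : firstVisit hφ N d = .inl ⟨d, hd⟩ :=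
  firstVisit_eq_inl hφ (j := 0) hd (by simp)

theorem exists_of_firstVisit_eq_inl [Finite H] (hφ : Function.Injective φ) {d : H} {k : {d // N d}} (h : firstVisit hφ N d = .inl k) :
    ∃ j, φ^[j] d = k.1 ∧ ∀ i < j, ¬ N (φ^[i] d) := by
  classical
  unfold firstVisit at h
  split_ifs at h with hex
  obtain rfl := Sum.inl.inj h
  exact ⟨_, rfl, fun i hi => Nat.find_min hex hi⟩

theorem eq_of_firstVisit_eq_inr [Finite H] (hφ : Function.Injective φ) {d : H} {q : AvoidingOrbit φ N} (h : firstVisit hφ N d = .inr q) :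
    q.1 = Quot.mk _ d := by
  classical
  unfold firstVisit at h
  split_ifs at h with hex
  obtain rfl := Sum.inr.inj h
  rfl

theorem firstVisit_of_quot_mk_eq [Finite H] (hφ : Function.Injective φ) {d : H} (q : AvoidingOrbit φ N) (h : Quot.mk _ d = q.1) :
    firstVisit hφ N d = .inr q := by
  cases e : firstVisit hφ N d with
  | inl k =>
    obtain ⟨j, hj, -⟩ := exists_of_firstVisit_eq_inl hφ e
    exact absurd ⟨k.1, k.2, by rw [← hj, quot_mk_iterate, h]⟩ q.2
  | inr q' => exact congrArg _ (Subtype.ext ((eq_of_firstVisit_eq_inr hφ e).trans h))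

theorem firstVisit_apply_of_not_mem [Finite H] (hφ : Function.Injective φ) {d : H} (hd : ¬ N d) :
    firstVisit hφ N (φ d) = firstVisit hφ N d := by
  cases e : firstVisit hφ N (φ d) with
  | inl k =>
    obtain ⟨j, hj, hlt⟩ := exists_of_firstVisit_eq_inl hφ e
    have hN : N (φ^[j + 1] d) := by rw [Function.iterate_succ_apply, hj]; exact k.2
    rw [firstVisit_eq_inl hφ hN]
    · exact congrArg _ (Subtype.ext hj.symm)
    · rintro (_ | i) hi
      · exact hd
      · rw [Function.iterate_succ_apply]
        exact hlt i (by omega)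
  | inr q =>
    exact (firstVisit_of_quot_mk_eq hφ q
      ((quot_mk_apply d).symm.trans (eq_of_firstVisit_eq_inr hφ e).symm)).symm

theorem firstVisit_apply_of_mem [Finite H] (hφ : Function.Injective φ) (h : {d // N d}) :
    firstVisit hφ N (φ h.1) = .inl (firstReturn hφ N h) := by
  obtain ⟨m, hm, e, hlt⟩ := isFirstReturn_firstReturn hφ h
  obtain ⟨m, rfl⟩ := Nat.exists_eq_succ_of_ne_zero hm.ne'
  have hN : N (φ^[m] (φ h.1)) := by
    rw [← Function.iterate_succ_apply, e]
    exact (firstReturn hφ N h).2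
  rw [firstVisit_eq_inl hφ hN]
  · exact congrArg _ (Subtype.ext e)
  · intro i hi
    rw [← Function.iterate_succ_apply]
    exact hlt _ (by omega) (by omega)

/-- Gluing along an involution of `N` does not unite orbits that avoid `N`. -/
theorem card_quot_add_card_avoidingOrbit_le [Finite H] (hφ : Function.Injective φ) {α : H → H} :
    Nat.card (Quot fun h k : {d // N d} => k.1 = α h.1 ∨ IsFirstReturn φ N h k)
      + Nat.card (AvoidingOrbit φ N)
      ≤ Nat.card (Quot fun d e => e = φ d ∨ N d ∧ N e ∧ e = α d) := by
  rw [← Nat.card_sum]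
  -- Only this inequality is needed, so it is enough that the class of the first visit is well
  -- defined and takes every value.
  refine Nat.card_le_card_of_surjective
    (Quot.lift (fun d => Sum.map (Quot.mk _) id (firstVisit hφ N d)) ?_) ?_
  · rintro d e (rfl | ⟨hd, he, rfl⟩)
    · by_cases hd : N d
      · rw [firstVisit_of_mem hφ hd, firstVisit_apply_of_mem hφ ⟨d, hd⟩]
        exact congrArg Sum.inl (Quot.sound (Or.inr (isFirstReturn_firstReturn hφ _)))
      · rw [firstVisit_apply_of_not_mem hφ hd]
    · rw [firstVisit_of_mem hφ hd, firstVisit_of_mem hφ he]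
      exact congrArg Sum.inl (Quot.sound (Or.inl rfl))
  · rintro (h | ⟨⟨d⟩, hq⟩)
    · induction h using Quot.ind with | _ h =>
      exact ⟨Quot.mk _ h.1, congrArg (Sum.map _ id) (firstVisit_of_mem hφ h.2)⟩
    · exact ⟨Quot.mk _ d, congrArg (Sum.map _ id) (firstVisit_of_quot_mk_eq hφ ⟨_, hq⟩ rfl)⟩

end FirstReturn
/-! ### State circles, abstractly -/

section Circles

variable {H : Type*} {φ α : H → H} {N P : H → Prop}

/-- With `P` read as "over": a circle that leaves under along an alternating edge arrives over,
turns left and leaves under again. It therefore stays on the boundary of one face until the next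
non-alternating edge. -/
theorem quot_mk_circle_iterate (hP : ∀ d, P (φ d) ↔ ¬ P (α d)) (hN : ∀ d, N d ↔ (P d ↔ P (α d)))
    (j : ℕ) (d : H) (hd : ¬ P d) (hlt : ∀ i < j, ¬ N (φ^[i] d)) :
    Quot.mk (fun d e => e = α d ∨ P (α d) ∧ e = φ d) d = Quot.mk _ (φ^[j] d) := by
  induction j generalizing d with
  | zero => rfl
  | succ j ih =>
    have hd' : ¬ N d := hlt 0 (Nat.succ_pos j)
    have hα : P (α d) := by
      by_contra h
      exact hd' ((hN d).2 (iff_of_false hd h))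
    rw [Function.iterate_succ_apply, ← ih (φ d) (fun h => (hP d).1 h hα)
      (fun i hi => by rw [← Function.iterate_succ_apply]; exact hlt _ (by omega))]
    exact Quot.sound (Or.inr ⟨hα, rfl⟩)

theorem quot_mk_circle_eq_of_curve (hP : ∀ d, P (φ d) ↔ ¬ P (α d))
    (hN : ∀ d, N d ↔ (P d ↔ P (α d))) {h k : {d // N d}}
    (e : k.1 = α h.1 ∨ P h.1 ∧ IsFirstReturn φ N h k) :
    Quot.mk (fun d e => e = α d ∨ P (α d) ∧ e = φ d) h.1 = Quot.mk _ k.1 := by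
  rcases e with e | ⟨hPh, m, hm, e, hlt⟩
  · exact Quot.sound (Or.inl e)
  · have hα : P (α h.1) := ((hN _).1 h.2).1 hPh
    obtain ⟨m, rfl⟩ := Nat.exists_eq_succ_of_ne_zero hm.ne'
    rw [← e, Function.iterate_succ_apply, ← quot_mk_circle_iterate hP hN m (φ h.1)
      (fun h' => (hP _).1 h' hα)
      (fun i hi => by rw [← Function.iterate_succ_apply]; exact hlt _ (by omega) (by omega))]
    exact Quot.sound (Or.inr ⟨hα, rfl⟩)

open Classical in
/-- A circle through `d` runs along the orbit of one of the two half-edges `d` and `α d`. -/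
noncomputable def circleVisit [Finite H] (hφ : Function.Injective φ) (α : H → H) (N P : H → Prop)
    (d : H) : (Quot fun h k : {d // N d} => k.1 = α h.1 ∨ P h.1 ∧ IsFirstReturn φ N h k)
      ⊕ AvoidingOrbit φ N :=
  Sum.map (Quot.mk _) id (firstVisit hφ N (if P d then α d else d))

theorem circleVisit_of_not [Finite H] (hφ : Function.Injective φ) {d : H} (hd : ¬ P d) :
    circleVisit hφ α N P d = Sum.map (Quot.mk _) id (firstVisit hφ N d) := by
  rw [circleVisit, if_neg hd]

theorem circleVisit_glue [Finite H] (hφ : Function.Injective φ) (hα : Function.Involutive α)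
    (hN : ∀ d, N d ↔ (P d ↔ P (α d))) (d : H) :
    circleVisit hφ α N P (α d) = circleVisit hφ α N P d := by
  by_cases hd : N d
  · have hd' : N (α d) := by rw [hN, hα]; exact ((hN d).1 hd).symm
    have key : Quot.mk (fun h k : {d // N d} => k.1 = α h.1 ∨ P h.1 ∧ IsFirstReturn φ N h k)
        ⟨d, hd⟩ = Quot.mk _ ⟨α d, hd'⟩ := Quot.sound (Or.inl rfl)
    unfold circleVisit
    rw [← (hN d).1 hd, hα]
    split_ifs
    · rw [firstVisit_of_mem hφ hd, firstVisit_of_mem hφ hd']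
      exact congrArg Sum.inl key
    · rw [firstVisit_of_mem hφ hd, firstVisit_of_mem hφ hd']
      exact congrArg Sum.inl key.symm
  · rw [hN] at hd
    unfold circleVisit
    by_cases h : P d <;> by_cases h' : P (α d) <;> simp_all [hα d]

theorem circleVisit_of_mem [Finite H] (hφ : Function.Injective φ) (hα : Function.Involutive α)
    (hN : ∀ d, N d ↔ (P d ↔ P (α d))) (h : {d // N d}) :
    circleVisit hφ α N P h.1 = .inl (Quot.mk _ h) := by
  by_cases hP : P h.1
  · have hd' : N (α h.1) := by rw [hN, hα]; exact ((hN _).1 h.2).symm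
    rw [circleVisit, if_pos hP, firstVisit_of_mem hφ hd']
    exact congrArg Sum.inl (Quot.sound (Or.inl (hα _).symm))
  · rw [circleVisit_of_not hφ hP, firstVisit_of_mem hφ h.2]
    rfl

theorem circleVisit_apply [Finite H] (hφ : Function.Injective φ) (hα : Function.Involutive α)
    (hP : ∀ d, P (φ d) ↔ ¬ P (α d)) (hN : ∀ d, N d ↔ (P d ↔ P (α d))) (d : H) (hd : P (α d)) :
    circleVisit hφ α N P (φ d) = circleVisit hφ α N P d := by
  rw [circleVisit_of_not hφ fun h => (hP d).1 h hd]
  by_cases h : N d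
  · rw [circleVisit_of_mem hφ hα hN ⟨d, h⟩, firstVisit_apply_of_mem hφ ⟨d, h⟩]
    have key := Quot.sound
      (r := fun h k : {d // N d} => k.1 = α h.1 ∨ P h.1 ∧ IsFirstReturn φ N h k)
      (Or.inr ⟨((hN d).1 h).2 hd, isFirstReturn_firstReturn hφ ⟨d, h⟩⟩)
    exact congrArg Sum.inl key.symm
  · rw [firstVisit_apply_of_not_mem hφ h,
      circleVisit_of_not hφ fun hPd => h ((hN d).2 (iff_of_true hPd hd))]

theorem quot_mk_circle_eq_ite (d : H) [Decidable (P d)] :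
    Quot.mk (fun d e => e = α d ∨ P (α d) ∧ e = φ d) d
      = Quot.mk _ (if P d then α d else d) := by
  split_ifs
  · exact Quot.sound (Or.inl rfl)
  · rfl

theorem quot_mk_circle_eq_of_circleVisit_eq [Finite H] (hφ : Function.Injective φ)
    (hα : Function.Involutive α) (hP : ∀ d, P (φ d) ↔ ¬ P (α d))
    (hN : ∀ d, N d ↔ (P d ↔ P (α d))) {d e : H}
    (h : circleVisit hφ α N P d = circleVisit hφ α N P e) :
    Quot.mk (fun d e => e = α d ∨ P (α d) ∧ e = φ d) d = Quot.mk _ e := by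
  classical
  -- The end selected by `circleVisit` either lies on a non-alternating edge or satisfies the
  -- starting condition of `quot_mk_circle_iterate`.
  have hite (d : H) : N (if P d then α d else d) ∨ ¬ P (if P d then α d else d) := by
    have h₁ := hN d
    have h₂ := hN (α d)
    rw [hα] at h₂
    split_ifs <;> tauto
  have hinl {d : H} {k : {d // N d}} (hd : N d ∨ ¬ P d) (h : firstVisit hφ N d = .inl k) :
      Quot.mk (fun d e => e = α d ∨ P (α d) ∧ e = φ d) d = Quot.mk _ k.1 := by
    obtain ⟨j, hj, hlt⟩ := exists_of_firstVisit_eq_inl hφ h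
    rcases hd with hd | hd
    · rw [firstVisit_of_mem hφ hd] at h
      rw [← Sum.inl.inj h]
    · rw [quot_mk_circle_iterate hP hN j d hd hlt, hj]
  rw [quot_mk_circle_eq_ite d, quot_mk_circle_eq_ite e]
  have hd := hite d
  have he := hite e
  unfold circleVisit at h
  generalize (if P d then α d else d) = d' at *
  generalize (if P e then α e else e) = e' at *
  cases hd' : firstVisit hφ N d' with
  | inl k =>
    cases he' : firstVisit hφ N e' with
    | inl k' =>
      rw [hd', he'] at h
      rw [hinl hd hd', hinl he he']
      exact congrArg (Quot.lift (fun h : {d // N d} => Quot.mk _ h.1)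
        fun h k e => quot_mk_circle_eq_of_curve hP hN e) (Sum.inl.inj h)
    | inr q' => simp [hd', he'] at h
  | inr q =>
    cases he' : firstVisit hφ N e' with
    | inl k' => simp [hd', he'] at h
    | inr q' =>
      rw [hd', he'] at h
      obtain rfl : q = q' := Sum.inr.inj h
      have h₁ := eq_of_firstVisit_eq_inr hφ hd'
      have h₂ := eq_of_firstVisit_eq_inr hφ he'
      have hav (i : ℕ) : ¬ N (φ^[i] d') := fun hi =>
        q.2 ⟨_, hi, by rw [quot_mk_iterate, h₁]⟩
      obtain ⟨j, rfl⟩ := exists_iterate_eq_of_quot_mk_eq hφ (h₁.symm.trans h₂)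
      exact quot_mk_circle_iterate hP hN j d' (hd.resolve_left (hav 0)) fun i _ => hav i

/-- Every state circle is a curve of the skeleton or the boundary of an alternating face. -/
theorem card_circle [Finite H] (hφ : Function.Injective φ) (hα : Function.Involutive α)
    (hP : ∀ d, P (φ d) ↔ ¬ P (α d)) (hN : ∀ d, N d ↔ (P d ↔ P (α d))) :
    Nat.card (Quot fun d e => e = α d ∨ P (α d) ∧ e = φ d) =
      Nat.card (Quot fun h k : {d // N d} => k.1 = α h.1 ∨ P h.1 ∧ IsFirstReturn φ N h k)
        + Nat.card {q : AvoidingOrbit φ N // ∃ d, ¬ P d ∧ Quot.mk _ d = q.1} := by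
  classical
  let f : (Quot fun d e => e = α d ∨ P (α d) ∧ e = φ d) →
      (Quot fun h k : {d // N d} => k.1 = α h.1 ∨ P h.1 ∧ IsFirstReturn φ N h k)
        ⊕ AvoidingOrbit φ N :=
    Quot.lift (circleVisit hφ α N P) <| by
      rintro d e (rfl | ⟨hd, rfl⟩)
      · exact (circleVisit_glue hφ hα hN d).symm
      · exact (circleVisit_apply hφ hα hP hN d hd).symm
  let g : (Quot fun h k : {d // N d} => k.1 = α h.1 ∨ P h.1 ∧ IsFirstReturn φ N h k)
        ⊕ {q : AvoidingOrbit φ N // ∃ d, ¬ P d ∧ Quot.mk _ d = q.1} →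
      (Quot fun h k : {d // N d} => k.1 = α h.1 ∨ P h.1 ∧ IsFirstReturn φ N h k)
        ⊕ AvoidingOrbit φ N := Sum.map id Subtype.val
  have hf : Function.Injective f := by
    rintro ⟨d⟩ ⟨e⟩ h
    exact quot_mk_circle_eq_of_circleVisit_eq hφ hα hP hN h
  have hg : Function.Injective g := Function.injective_id.sumMap Subtype.val_injective
  -- Both sides of the claim embed in the same sum, so it suffices to compare images. An orbit that
  -- avoids `N` is hit exactly when it has a half-edge outside `P`.
  have hfg : Set.range f = Set.range g := by
    apply Set.Subset.antisymm
    · rintro _ ⟨⟨d⟩, rfl⟩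
      change circleVisit hφ α N P d ∈ _
      unfold circleVisit
      cases hd : firstVisit hφ N (if P d then α d else d) with
      | inl k => exact ⟨Sum.inl (Quot.mk _ k), rfl⟩
      | inr q =>
        have hq := eq_of_firstVisit_eq_inr hφ hd
        refine ⟨Sum.inr ⟨q, _, ?_, hq.symm⟩, rfl⟩
        intro hPd
        refine q.2 ⟨_, ?_, hq.symm⟩
        rw [hN]
        split_ifs at hPd ⊢ with h
        · rw [hα]
          exact iff_of_true hPd h
        · exact absurd hPd h
    · rintro _ ⟨h | ⟨q, d, hd, hq⟩, rfl⟩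
      · induction h using Quot.ind with | _ h =>
        exact ⟨Quot.mk _ h.1, circleVisit_of_mem hφ hα hN h⟩
      · refine ⟨Quot.mk _ d, ?_⟩
        change circleVisit hφ α N P d = _
        rw [circleVisit_of_not hφ hd, firstVisit_of_quot_mk_eq hφ q hq]
        rfl
  rw [← Nat.card_sum, ← Nat.card_range_of_injective hf, hfg, Nat.card_range_of_injective hg]

/-- At an alternating face, all half-edges are of the same kind. -/
theorem card_avoidingOrbit [Finite H] (hφ : Function.Injective φ)
    (hP : ∀ d, P (φ d) ↔ ¬ P (α d)) (hN : ∀ d, N d ↔ (P d ↔ P (α d))) :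
    Nat.card {q : AvoidingOrbit φ N // ∃ d, ¬ P d ∧ Quot.mk _ d = q.1}
      + Nat.card {q : AvoidingOrbit φ N // ∃ d, ¬ ¬ P d ∧ Quot.mk _ d = q.1}
      = Nat.card (AvoidingOrbit φ N) := by
  classical
  have key (q : AvoidingOrbit φ N) : (∃ d, ¬ ¬ P d ∧ Quot.mk _ d = q.1) ↔
      ¬ ∃ d, ¬ P d ∧ Quot.mk _ d = q.1 := by
    constructor
    -- An alternating edge changes the kind and so does the turn at its end; the two changes cancel.
    · rintro ⟨d, hd, hdq⟩ ⟨e, he, heq⟩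
      obtain ⟨j, rfl⟩ := exists_iterate_eq_of_quot_mk_eq hφ (hdq.trans heq.symm)
      refine he ?_
      clear he heq
      induction j with
      | zero => exact not_not.1 hd
      | succ j ih =>
        have hav : ¬ N (φ^[j] d) := fun hN => q.2 ⟨_, hN, by rw [quot_mk_iterate, hdq]⟩
        rw [hN] at hav
        rw [Function.iterate_succ_apply', hP]
        tauto
    · intro h
      obtain ⟨⟨d⟩, hq⟩ := q
      exact ⟨d, fun hd => h ⟨d, hd, rfl⟩, rfl⟩
  simp_rw [key]
  rw [← Nat.card_sum]
  exact Nat.card_congr (Equiv.sumCompl _)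

end Circles
/-! ### Curves of the skeleton, abstractly -/

theorem card_curve_add_card_curve_le {H : Type*} [Finite H] {φ α : H → H} {N P : H → Prop}
    (hφ : Function.Injective φ) (hα : Function.Involutive α) (hne : ∀ d, α d ≠ d)
    (hP : ∀ d, P (φ d) ↔ ¬ P (α d)) (hN : ∀ d, N d ↔ (P d ↔ P (α d))) :
    Nat.card (Quot fun h k : {d // N d} => k.1 = α h.1 ∨ P h.1 ∧ IsFirstReturn φ N h k)
      + Nat.card (Quot fun h k : {d // N d} => k.1 = α h.1 ∨ ¬ P h.1 ∧ IsFirstReturn φ N h k)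
      + Nat.card (Quot (IsFirstReturn φ N)) + Nat.card (Quot fun h k : {d // N d} => k.1 = α h.1)
      ≤ Nat.card {d // N d}
        + 2 * Nat.card (Quot fun h k : {d // N d} => k.1 = α h.1 ∨ IsFirstReturn φ N h k) := by
  have := Fintype.ofFinite {d // N d}
  have hNα (d : H) (hd : N d) : N (α d) := by rw [hN, hα]; exact ((hN d).1 hd).symm
  -- Signs alternate around a vertex of the skeleton: the first step leaves along a non-alternating
  -- edge and changes the kind, and the later steps run along alternating edges and keep it.
  have hret (h : {d // N d}) : P (firstReturn hφ N h).1 ↔ ¬ P h.1 := by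
    obtain ⟨m, hm, e, hlt⟩ := isFirstReturn_firstReturn hφ h
    have key : ∀ j, 0 < j → j ≤ m → (P (φ^[j] h.1) ↔ ¬ P h.1) := by
      intro j hj
      induction j, hj using Nat.le_induction with
      | base => intro _; rw [Function.iterate_one, hP, (hN _).1 h.2]
      | succ j hj ih =>
        intro hjm
        have h₁ := hlt j hj (by omega)
        rw [hN] at h₁
        rw [Function.iterate_succ_apply', hP, ← ih (by omega)]
        tauto
    rw [← e, key m hm le_rfl]
  let E := invariants fun h k : {d // N d} => k.1 = α h.1
  let A := invariants fun h k : {d // N d} => P h.1 ∧ IsFirstReturn φ N h k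
  let B := invariants fun h k : {d // N d} => ¬ P h.1 ∧ IsFirstReturn φ N h k
  have hAB : A ⊓ B = invariants (IsFirstReturn φ N) := by
    rw [← invariants_or]
    congr! 4 with h k
    tauto
  have h := finrank_inf_add_finrank_inf_add_finrank_inf_le A B E
    (fun f hf g hg => dotProduct_eq_zero_of_perm (firstReturn hφ N) (fun h => P h.1) hret
      (fun h hh => hf _ _ ⟨hh, isFirstReturn_firstReturn hφ h⟩)
      (fun h hh => hg _ _ ⟨hh, isFirstReturn_firstReturn hφ h⟩))
    (fun f hf g hg => dotProduct_eq_zero_of_perm (firstReturn hφ N) (fun h => ¬ P h.1)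
      (fun h => not_congr (hret h))
      (fun h hh => hf _ _ ⟨hh, isFirstReturn_firstReturn hφ h⟩)
      (fun h hh => hg _ _ ⟨hh, isFirstReturn_firstReturn hφ h⟩))
    (fun f hf g hg => dotProduct_eq_zero_of_involutive
      (τ := fun h : {d // N d} => ⟨α h.1, hNα _ h.2⟩) (fun h => Subtype.ext (hα h.1))
      (fun h hh => hne h.1 (Subtype.ext_iff.1 hh)) (fun h => hf _ _ rfl) (fun h => hg _ _ rfl))
  rw [hAB] at h
  simp only [E, A, B, finrank_invariants_inf, finrank_invariants] at h
  exact h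

theorem card_quot_congr {X : Type*} {r s : X → X → Prop}
    (h₁ : ∀ x y, r x y → Quot.mk s x = Quot.mk s y)
    (h₂ : ∀ x y, s x y → Quot.mk r x = Quot.mk r y) : Nat.card (Quot r) = Nat.card (Quot s) :=
  Nat.card_congr
    { toFun := Quot.lift (Quot.mk s) h₁
      invFun := Quot.lift (Quot.mk r) h₂
      left_inv := by rintro ⟨x⟩; rfl
      right_inv := by rintro ⟨x⟩; rfl }

/-! ### Link diagrams -/

namespace CrossingMap

variable {C : Type*} (D : CrossingMap C)

theorem glue_involutive : Function.Involutive D.glue := D.glue_glue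

theorem leftTurn_injective : Function.Injective D.leftTurn := by
  intro d e h
  have h₁ := congrArg Prod.fst h
  have h₂ := congrArg Prod.snd h
  exact D.glue_involutive.injective (Prod.ext h₁ (sub_left_injective h₂))

theorem leftTurn_glue (d : C × ZMod 4) : D.leftTurn (D.glue d) = (d.1, d.2 - 1) := by
  rw [leftTurn, D.glue_glue]

theorem two_mul_card_edge [Finite C] : 2 * Nat.card D.Edge = 4 * Nat.card C := by
  rw [mul_comm 4, ← Nat.card_zmod 4, ← Nat.card_prod]
  exact two_mul_card_quot_of_involutive_of_ne D.glue_involutive D.glue_ne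

end CrossingMap

theorem eq_apply_zero_of_apply_sub_one {C Y : Type*} {f : C × ZMod 4 → Y}
    (h : ∀ c i, f (c, i) = f (c, i - 1)) (c : C) (i : ZMod 4) : f (c, i) = f (c, 0) := by
  have h₁ : f (c, 1) = f (c, 0) := h c 1
  have h₂ : f (c, 2) = f (c, 1) := h c 2
  have h₃ : f (c, 3) = f (c, 2) := h c 3
  have hi : i = 0 ∨ i = 1 ∨ i = 2 ∨ i = 3 := by revert i; decide
  rcases hi with rfl | rfl | rfl | rfl
  · rfl
  · exact h₁
  · exact h₂.trans h₁
  · exact h₃.trans (h₂.trans h₁)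

namespace LinkDiagram

variable {C : Type*} (D : LinkDiagram C)

theorem isOver_leftTurn (d : C × ZMod 4) : IsOver (D.leftTurn d) ↔ ¬ IsOver (D.glue d) := by
  have h : ∀ i : ZMod 4, (i - 1 = 0 ∨ i - 1 = 2) ↔ ¬ (i = 0 ∨ i = 2) := by decide
  exact h _

theorem isNonalternating_glue (d : C × ZMod 4) :
    D.IsNonalternating (D.glue d) ↔ D.IsNonalternating d := by
  rw [IsNonalternating, IsNonalternating, D.glue_glue]
  exact iff_comm

open Classical in
-- By `hP` the kinds alternate around a crossing, so every arc of the split has one end in `P`.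
-- Arriving at that end, the arc is a left turn; its other end gives the same arc reversed.
theorem card_circle_eq {P : C × ZMod 4 → Prop} {L : Label}
    (hP : ∀ d, P (D.leftTurn d) ↔ ¬ P (D.glue d))
    (hL : ∀ d, splitPartner L d = if P d then (d.1, d.2 - 1) else (d.1, d.2 + 1)) :
    Nat.card (Quot fun d e : C × ZMod 4 => e = D.glue d ∨ e = splitPartner L d) =
      Nat.card (Quot fun d e => e = D.glue d ∨ P (D.glue d) ∧ e = D.leftTurn d) := by
  let s : C × ZMod 4 → C × ZMod 4 → Prop :=
    fun d e => e = D.glue d ∨ P (D.glue d) ∧ e = D.leftTurn d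
  have key (d : C × ZMod 4) (hd : P d) : Quot.mk s d = Quot.mk s (d.1, d.2 - 1) := by
    rw [← D.leftTurn_glue]
    refine (Quot.sound (Or.inl rfl) : _ = Quot.mk s (D.glue d)).trans (Quot.sound (Or.inr ⟨?_, rfl⟩))
    rwa [D.glue_glue]
  apply card_quot_congr
  · rintro d e (rfl | rfl)
    · exact Quot.sound (Or.inl rfl)
    · rw [hL]
      split_ifs with hd
      · exact key d hd
      · have h := key (d.1, d.2 + 1) <| by
          have := hP (D.glue (d.1, d.2 + 1))
          rw [D.leftTurn_glue, D.glue_glue] at this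
          simp only [add_sub_cancel_right, Prod.mk.eta] at this
          tauto
        simpa using h.symm
  · rintro d e (rfl | ⟨hd, rfl⟩)
    · exact Quot.sound (Or.inl rfl)
    · refine (Quot.sound (Or.inl rfl) : _ = Quot.mk _ (D.glue d)).trans (Quot.sound (Or.inr ?_))
      rw [hL, if_pos hd]
      rfl

theorem numCircles_stateA : D.numCircles D.stateA =
    Nat.card (Quot fun d e => e = D.glue d ∨ IsOver (D.glue d) ∧ e = D.leftTurn d) := by
  classical
  exact D.card_circle_eq D.isOver_leftTurn fun d => by
    unfold splitPartner
    congr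

theorem numCircles_stateB : D.numCircles D.stateB =
    Nat.card (Quot fun d e => e = D.glue d ∨ ¬ IsOver (D.glue d) ∧ e = D.leftTurn d) := by
  classical
  exact D.card_circle_eq (P := fun d => ¬ IsOver d) (fun d => not_congr (D.isOver_leftTurn d))
    fun d => by
      unfold splitPartner
      by_cases h : IsOver d <;> simp [h]

theorem numCircles_stateA_add_numCircles_stateB [Finite C] :
    D.numCircles D.stateA + D.numCircles D.stateB
      = D.numCurvesA + D.numCurvesB + Nat.card (AvoidingOrbit D.leftTurn D.IsNonalternating) := by
  have hA := card_circle D.leftTurn_injective D.glue_involutive D.isOver_leftTurn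
    (N := D.IsNonalternating) fun d => Iff.rfl
  have hB := card_circle (P := fun d => ¬ IsOver d) D.leftTurn_injective D.glue_involutive
    (fun d => not_congr (D.isOver_leftTurn d)) (N := D.IsNonalternating)
    fun d => not_iff_not.symm
  have hAB := card_avoidingOrbit D.leftTurn_injective D.isOver_leftTurn
    (N := D.IsNonalternating) fun d => Iff.rfl
  rw [← numCircles_stateA] at hA
  rw [← numCircles_stateB] at hB
  change _ = D.numCurvesA + _ at hA
  change _ = D.numCurvesB + _ at hB
  omega

theorem card_face [Finite C] : Nat.card D.Face =
    D.numVertices + Nat.card (AvoidingOrbit D.leftTurn D.IsNonalternating) := by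
  classical
  have : Finite D.Face := inferInstanceAs (Finite (Quot _))
  rw [numVertices, ← Nat.card_congr (Equiv.sumCompl fun f : D.Face =>
    ∃ d, D.IsNonalternating d ∧ D.face d = f), Nat.card_sum]
  rfl

theorem two_mul_numNonalternating [Finite C] :
    2 * D.numNonalternating = Nat.card {d // D.IsNonalternating d} := by
  have h := two_mul_card_quot_of_involutive_of_ne
    (τ := fun h : {d // D.IsNonalternating d} => ⟨D.glue h.1, (D.isNonalternating_glue _).2 h.2⟩)
    (fun h => Subtype.ext (D.glue_glue h.1)) fun h hh => D.glue_ne h.1 (Subtype.ext_iff.1 hh)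
  simp only [Subtype.ext_iff] at h
  exact h

theorem card_quot_leftTurn_or_glue_le [Finite C] :
    Nat.card (Quot fun d e => e = D.leftTurn d ∨ e = D.glue d) ≤ Nat.card D.Component := by
  let r : C × ZMod 4 → C × ZMod 4 → Prop := fun d e => e = D.leftTurn d ∨ e = D.glue d
  have hmk := eq_apply_zero_of_apply_sub_one (f := Quot.mk r) fun c i =>
    (Quot.sound (Or.inr rfl) : _ = Quot.mk r (D.glue (c, i))).trans
      (Quot.sound (Or.inl (D.leftTurn_glue (c, i)).symm))
  have : Finite D.Component := inferInstanceAs (Finite (Quot _))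
  refine Nat.card_le_card_of_surjective
    (Quot.lift (fun c => Quot.mk r (c, 0)) ?_ : D.Component → Quot r) ?_
  · rintro c c' ⟨i, j, h⟩
    rw [← hmk c i, ← hmk c' j, ← h]
    exact Quot.sound (Or.inr rfl)
  · rintro ⟨c, i⟩
    exact ⟨Quot.mk _ c, (hmk c i).symm⟩

/-! ### Euler's inequality for the skeleton -/

open Classical in
/-- The involution that glues the alternating edges only. -/
noncomputable def alternatingGlue (d : C × ZMod 4) : C × ZMod 4 :=
  if D.IsNonalternating d then d else D.glue d

theorem alternatingGlue_involutive : Function.Involutive D.alternatingGlue := by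
  intro d
  by_cases h : D.IsNonalternating d
  · simp [alternatingGlue, h]
  · simp [alternatingGlue, h, D.isNonalternating_glue, D.glue_glue]

theorem card_quot_alternatingGlue [Finite C] :
    Nat.card (Quot fun d e => e = D.alternatingGlue d)
      = 2 * Nat.card C + D.numNonalternating := by
  have h := two_mul_card_quot_of_involutive D.alternatingGlue_involutive
  have h' : ∀ d, D.alternatingGlue d = d ↔ D.IsNonalternating d := fun d => by
    by_cases hd : D.IsNonalternating d
    · simp [alternatingGlue, hd]
    · simp [alternatingGlue, hd, D.glue_ne]
  simp_rw [h'] at h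
  rw [← two_mul_numNonalternating, Nat.card_prod, Nat.card_zmod] at h
  omega

theorem card_quot_fst_or_alternatingGlue_le [Finite C] :
    Nat.card (Quot fun d e : C × ZMod 4 => e.1 = d.1 ∨ e = D.alternatingGlue d)
      ≤ D.numRegions := by
  let r : C × ZMod 4 → C × ZMod 4 → Prop := fun d e => e.1 = d.1 ∨ e = D.alternatingGlue d
  have hmk (c : C) (i j : ZMod 4) : Quot.mk r (c, i) = Quot.mk r (c, j) :=
    Quot.sound (Or.inl rfl)
  have : Finite D.Region := inferInstanceAs (Finite (Quot _))
  refine Nat.card_le_card_of_surjective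
    (Quot.lift (fun c => Quot.mk r (c, 0)) ?_ : D.Region → Quot r) ?_
  · rintro c c' ⟨i, j, h, hN⟩
    rw [hmk c 0 i, hmk c' 0 j, ← h]
    exact Quot.sound (Or.inr (by rw [alternatingGlue, if_neg hN]))
  · rintro ⟨c, i⟩
    exact ⟨Quot.mk _ c, hmk c 0 i⟩

/-- An inequality of Euler type for the dual graph restricted to the non-alternating edges. -/
theorem card_quot_add_numNonalternating_le [Finite C] :
    Nat.card (Quot fun d e => e = D.leftTurn d ∨
        D.IsNonalternating d ∧ D.IsNonalternating e ∧ e = D.glue d) + D.numNonalternating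
      ≤ D.numRegions + Nat.card C + Nat.card D.Component := by
  classical
  have := Fintype.ofFinite C
  let V := invariants fun d e => e = D.leftTurn d ∨
    D.IsNonalternating d ∧ D.IsNonalternating e ∧ e = D.glue d
  -- `V` consists of functions on the faces that agree across non-alternating edges, and `δ` is the
  -- coboundary across edges. On `V` its values vanish on non-alternating edges, and its kernel is
  -- constant on components.
  let δ : (C × ZMod 4 → ZMod 2) →ₗ[ZMod 2] (C × ZMod 4 → ZMod 2) :=
    LinearMap.id - LinearMap.funLeft (ZMod 2) (ZMod 2) D.glue
  let M := invariants fun d e : C × ZMod 4 => e.1 = d.1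
  let T := invariants fun d e => e = D.alternatingGlue d
  have hker : Module.finrank (ZMod 2) (LinearMap.ker (δ.domRestrict V)) ≤
      Nat.card D.Component := by
    refine le_trans ?_ D.card_quot_leftTurn_or_glue_le
    rw [← finrank_invariants, ← Submodule.finrank_map_subtype_eq V]
    refine Submodule.finrank_mono ?_
    rintro _ ⟨⟨f, hf⟩, hf', rfl⟩ d e (rfl | rfl)
    · exact hf _ _ (Or.inl rfl)
    · exact sub_eq_zero.1 (congrFun (LinearMap.mem_ker.1 hf') d)
  have hrank := LinearMap.finrank_range_add_finrank_ker (δ.domRestrict V)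
  have horth : ∀ f ∈ LinearMap.range (δ.domRestrict V), ∀ g ∈ M ⊔ T, f ⬝ᵥ g = 0 := by
    rintro _ ⟨⟨f, hf⟩, rfl⟩ g hg
    obtain ⟨g₁, h₁, g₂, h₂, rfl⟩ := Submodule.mem_sup.1 hg
    change (fun d => f d - f (D.glue d)) ⬝ᵥ (g₁ + g₂) = 0
    rw [dotProduct_add]
    -- The differences across the four edges at a crossing telescope around it.
    have e₁ : (fun d => f d - f (D.glue d)) ⬝ᵥ g₁ = 0 := by
      simp only [dotProduct, sub_mul, Finset.sum_sub_distrib]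
      rw [sub_eq_zero, ← Equiv.sum_comp ((Equiv.refl C).prodCongr (Equiv.subRight (1 : ZMod 4)))]
      refine Finset.sum_congr rfl fun d _ => ?_
      have hf' := hf (D.glue d) _ (Or.inl rfl)
      rw [D.leftTurn_glue] at hf'
      rw [hf', h₁ d (d.1, d.2 - 1) rfl]
      rfl
    -- The two halves of an edge cancel: the difference vanishes if the edge is non-alternating, and
    -- otherwise `g₂` agrees on the halves while the difference changes sign.
    have e₂ : (fun d => f d - f (D.glue d)) ⬝ᵥ g₂ = 0 := by
      refine Finset.sum_involution (fun d _ => D.glue d) (fun d _ => ?_)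
        (fun d _ _ => D.glue_ne d) (fun d _ => Finset.mem_univ _) (fun d _ => D.glue_glue d)
      beta_reduce
      rw [D.glue_glue]
      by_cases hd : D.IsNonalternating d
      · rw [hf d (D.glue d) (Or.inr ⟨hd, (D.isNonalternating_glue d).2 hd, rfl⟩)]
        ring
      · rw [h₂ d (D.glue d) (if_neg hd).symm]
        ring
    rw [e₁, e₂, add_zero]
  -- The dimension of `M ⊔ T` is at least $c+(2c+\nu)-n$, inside a space of dimension $4c$.
  have hdim := finrank_add_finrank_le_of_dotProduct_eq_zero _ _ horth
  have hsup := Submodule.finrank_sup_add_finrank_inf_eq M T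
  have hM : Nat.card C ≤ Nat.card (Quot fun d e : C × ZMod 4 => e.1 = d.1) :=
    Nat.card_le_card_of_surjective (Quot.lift Prod.fst fun _ _ h => h.symm)
      fun c => ⟨Quot.mk _ (c, 0), rfl⟩
  have hn := D.card_quot_fst_or_alternatingGlue_le
  have hq := D.card_quot_alternatingGlue
  rw [Nat.card_prod, Nat.card_zmod] at hdim
  rw [finrank_invariants] at hrank
  rw [finrank_invariants_inf, finrank_invariants, finrank_invariants] at hsup
  omega

theorem numCurvesA_add_numCurvesB_add_le [Finite C] :
    D.numCurvesA + D.numCurvesB + D.numVertices ≤ D.numNonalternating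
      + 2 * Nat.card (Quot fun h k : {d // D.IsNonalternating d} =>
        k.1 = D.glue h.1 ∨ IsFirstReturn D.leftTurn D.IsNonalternating h k) := by
  have h := card_curve_add_card_curve_le (N := D.IsNonalternating) D.leftTurn_injective
    D.glue_involutive D.glue_ne D.isOver_leftTurn fun d => Iff.rfl
  rw [card_quot_isFirstReturn D.leftTurn_injective, ← two_mul_numNonalternating] at h
  change D.numCurvesA + D.numCurvesB + D.numVertices + D.numNonalternating ≤ _ at h
  omega

end LinkDiagram

theorem mainTheorem3 {C : Type*} [Finite C] (D : LinkDiagram C) (hD : D.IsNonsplit) :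
    D.extremeStatesBound = D.skeletonBound ∧
      D.extremeStatesBound ≤ D.thistlethwaiteBound := by
  have hcirc := D.numCircles_stateA_add_numCircles_stateB
  have hface := D.card_face
  have hedge := D.two_mul_card_edge
  have hplanar := D.planar
  have hcurve := D.numCurvesA_add_numCurvesB_add_le
  have heuler := D.card_quot_add_numNonalternating_le
  have hglue := card_quot_add_card_avoidingOrbit_le (N := D.IsNonalternating) (α := D.glue)
    D.leftTurn_injective
  have hcomp : Nat.card D.Component = 1 := hD
  unfold LinkDiagram.extremeStatesBound LinkDiagram.skeletonBound LinkDiagram.thistlethwaiteBound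
    LinkDiagram.crossingNumber
  -- Planarity and $E=2c$ give $c+2$ faces. This turns `hcirc` and `hface` into the equality, and
  -- `hglue`, `heuler` into $k+1+\nu\le n+v(G)$; twice this added to `hcurve` eliminates $k$.
  omega
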